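/- For a set $X$ and a cardinal $\kappa$, let $[X]^{\kappa}$ (resp. $[X]^{\ge\kappa}$, $[X]^{<\kappa}$) be the family of all subsets of $X$ of cardinality $\kappa$ (resp. at least $\kappa$, less than $\kappa$). A family $\mathcal A$ of sets is $\mu$-almost disjoint if $|A\cap A'|<\mu$ for all distinct $A,A'\in\mathcal A$. A family $\mathcal A\subset[X]^{\kappa}$ is essentially disjoint if for each $A\in\mathcal A$ there is a set $F(A)\in[A]^{<\kappa}$ such that the sets $A\setminus F(A)$, $A\in\mathcal A$, are pairwise disjoint. For a function $f$ and a set $A$, let $I_f(A)=\{\xi\in\operatorname{ran}(f): |A\cap f^{-1}\{\xi\}|=1\}$. A conflict-free coloring of $\mathcal A$ with $\rho$ colors is a function $f:\bigcup\mathcal A\to\rho$ such that $I_f(A)\neq\emptyset$ for all $A\in\mathcal A$. Let $\mathrm{CF}(\lambda,{\ge}\kappa,\mu,\rho)$ be the statement that every $\mu$-almost disjoint family $\mathcal A\subset[\lambda]^{\ge\kappa}$ has a conflict-free coloring with $\rho$ colors. **Corollary.** Let $\mu\le\kappa\le\lambda$ be cardinals with $\kappa$ infinite, and suppose that every $\mu$-almost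 disjoint family $\mathcal A\subset[\lambda]^{\kappa}$ is essentially disjoint. Then for every $\mu$-almost disjoint family $\mathcal A\subset[\lambda]^{\ge\kappa}$ there is a coloring $f:\lambda\to\kappa$ such that $|I_f(A)|=\kappa$ for all $A\in\mathcal A$. In particular, $\mathrm{CF}(\lambda,{\ge}\kappa,\mu,\kappa)$ holds. -/

import Mathlib

universe u

open Cardinal

/-- The underlying set of the cardinal `c`, that is, the set of all ordinals below its initial
ordinal. It has cardinality `c`. -/
abbrev CardSet (c : Cardinal.{u}) : Type u := c.ord.ToType

/-- The family `[X]^κ` of all subsets of `X` of cardinality exactly `κ`. -/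
def setsOfCard (X : Type u) (κ : Cardinal.{u}) : Set (Set X) := {A | #A = κ}

/-- The family `[X]^{≥κ}` of all subsets of `X` of cardinality at least `κ`. -/
def setsOfCardGE (X : Type u) (κ : Cardinal.{u}) : Set (Set X) := {A | κ ≤ #A}

/-- `𝒜` is `μ`-almost disjoint: distinct members meet in fewer than `μ` points. -/
def AlmostDisjointFamily {X : Type u} (μ : Cardinal.{u}) (𝒜 : Set (Set X)) : Prop :=
  ∀ A ∈ 𝒜, ∀ B ∈ 𝒜, A ≠ B → #(A ∩ B : Set X) < μ

/-- A family `𝒜 ⊆ [X]^κ` is essentially disjoint: from each member `A` one can remove a subset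
`F A` of size less than `κ` so that the remainders are pairwise disjoint. -/
def EssentiallyDisjoint {X : Type u} (κ : Cardinal.{u}) (𝒜 : Set (Set X)) : Prop :=
  ∃ F : Set X → Set X, (∀ A ∈ 𝒜, F A ⊆ A ∧ #(F A) < κ) ∧
    ∀ A ∈ 𝒜, ∀ B ∈ 𝒜, A ≠ B → Disjoint (A \ F A) (B \ F B)

/-- Every `μ`-almost disjoint family of subsets of the cardinal `lam` of size `κ` is essentially
disjoint. -/
def AlmostDisjointToED (lam κ μ : Cardinal.{u}) : Prop :=
  ∀ 𝒜 : Set (Set (CardSet lam)), 𝒜 ⊆ setsOfCard (CardSet lam) κ →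
    AlmostDisjointFamily μ 𝒜 → EssentiallyDisjoint κ 𝒜

/-- `I_f(A)`: the colors `ξ` in the range of `f` that occur exactly once in `A`. -/
def uniqueColors {D C : Type u} (f : D → C) (A : Set D) : Set C :=
  {ξ | ξ ∈ Set.range f ∧ #(A ∩ f ⁻¹' {ξ} : Set D) = 1}

/-- `f` is a conflict-free coloring of `𝒜`: its domain is the union of `𝒜`, and every member of
`𝒜` has a color that occurs in it exactly once. -/
def IsConflictFree {X C : Type u} (𝒜 : Set (Set X)) (f : ↥(⋃₀ 𝒜) → C) : Prop :=
  ∀ A ∈ 𝒜, (uniqueColors f {x : ↥(⋃₀ 𝒜) | (x : X) ∈ A}).Nonempty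

/-- `CF(lam, ≥κ, μ, ρ)`: every `μ`-almost disjoint family of subsets of `lam` of size at least `κ`
has a conflict-free coloring with `ρ` colors. -/
def CFGE (lam κ μ ρ : Cardinal.{u}) : Prop :=
  ∀ 𝒜 : Set (Set (CardSet lam)), 𝒜 ⊆ setsOfCardGE (CardSet lam) κ →
    AlmostDisjointFamily μ 𝒜 → ∃ f : ↥(⋃₀ 𝒜) → CardSet ρ, IsConflictFree 𝒜 f

/-! Induct on the size of the ground set `D`, coloring by pairs from `C × C` with `#C = κ`. If `#D ≤
κ`, the first coordinate can be injective. Otherwise a rank cuts `D` into smaller slices so that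
each member has a stage: fewer than `κ` of its points come before it, at least `κ` lie in it, and
each point lies in at most one member whose stage precedes it (`IndexedED.exists_stages`). Slices
are colored in order, and a point past the stage of a member avoids the colors reserved for that
member. Reserved colors have distinct first coordinates, so at most one new color per column is
forbidden. This is why the induction carries forbidden sets that are finite in every column.
Dropping the fewer than `κ` reserved colors used by earlier points still leaves `κ`.

The stages come from closed sets containing `κ` points of any member whose remainder they meet.
Their hulls stay small because, after fewer than `κ` points are removed from each member, every
point lies in at most `κ` remainders (`IndexedED.exists_essentially_le_to_one`, a separate induction
on `#D`). -/

/-! ### Cardinal bounds, closure operators and filtrations -/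

theorem mk_biUnion_le_of_forall_le {X ι : Type u} {τ : Cardinal.{u}} (hτ : ℵ₀ ≤ τ) (s : Set ι)
    (A : ι → Set X) (hs : #s ≤ τ) (hA : ∀ i ∈ s, #(A i) ≤ τ) : #(⋃ i ∈ s, A i : Set X) ≤ τ := by
  refine (mk_biUnion_le A s).trans ((mul_le_mul' hs (ciSup_le' fun i : s => hA i i.2)).trans ?_)
  rw [mul_eq_self hτ]

theorem mk_union_le_of_le {X : Type u} {τ : Cardinal.{u}} (hτ : ℵ₀ ≤ τ) {S T : Set X}
    (hS : #S ≤ τ) (hT : #T ≤ τ) : #(S ∪ T : Set X) ≤ τ :=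
  (mk_union_le S T).trans ((add_le_add hS hT).trans (add_eq_self hτ).le)

theorem mk_union_lt_of_lt {X : Type u} {τ : Cardinal.{u}} (hτ : ℵ₀ ≤ τ) {S T : Set X}
    (hS : #S < τ) (hT : #T < τ) : #(S ∪ T : Set X) < τ :=
  (mk_union_le S T).trans_lt (add_lt_of_lt hτ hS hT)

/-- Removing fewer than `τ` points from a set of size at least `τ` leaves at least `τ` points. -/
theorem le_mk_of_subset_union {X : Type u} {τ : Cardinal.{u}} (hτ : ℵ₀ ≤ τ) {A S T : Set X}
    (hA : τ ≤ #A) (h : A ⊆ S ∪ T) (hT : #T < τ) : τ ≤ #S := by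
  by_contra! hS
  exact absurd (hA.trans (mk_le_mk_of_subset h)) (mk_union_lt_of_lt hτ hS hT).not_ge

theorem mk_lt_of_subset {X : Type u} {τ : Cardinal.{u}} {S T : Set X} (h : S ⊆ T) (hT : #T < τ) :
    #S < τ :=
  (mk_le_mk_of_subset h).trans_lt hT

theorem le_mk_of_subset {X : Type u} {τ : Cardinal.{u}} {S T : Set X} (h : S ⊆ T) (hS : τ ≤ #S) :
    τ ≤ #T :=
  hS.trans (mk_le_mk_of_subset h)

/-- A set each of whose initial segments with respect to `r` has size less than `κ` has size at
most `κ`. -/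
theorem mk_le_of_initial_segments_lt {X ι : Type u} [LinearOrder ι] (r : X → ι)
    {κ : Cardinal.{u}} (hκ : ℵ₀ ≤ κ) (B : Set X)
    (hB : ∀ x ∈ B, #{y | y ∈ B ∧ r y ≤ r x} < κ) : #B ≤ κ := by
  by_contra! h
  -- The segments below the points of `T` cover `B`: a point outside them would have all `κ` points
  -- of `T` below it.
  obtain ⟨T, hTB, hT⟩ := le_mk_iff_exists_subset.1 h.le
  refine h.not_ge ((mk_le_mk_of_subset fun y hy => ?_).trans
    (mk_biUnion_le_of_forall_le hκ T (fun x => {y | y ∈ B ∧ r y ≤ r x}) hT.le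
      fun x hx => (hB x (hTB hx)).le))
  by_contra hn
  simp only [Set.mem_iUnion, Set.mem_ofPred_eq, not_exists, not_and, not_le] at hn
  refine (hB y hy).not_ge (hT.ge.trans (mk_le_mk_of_subset fun z hz => ⟨hTB hz, (hn z hz hy).le⟩))

/-- Closing a set off under a monotone set operator of small growth, for arguments of size less
than the regular cardinal `θ`. -/
theorem exists_closed_superset {X : Type u} {θ τ : Cardinal.{u}} (hθ : θ.IsRegular) (hθτ : θ ≤ τ)
    (Φ : Set X → Set X) (hmono : Monotone Φ) (hsize : ∀ S : Set X, #S ≤ τ → #(Φ S) ≤ τ) (S : Set X)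
    (hS : #S ≤ τ) :
    ∃ U, S ⊆ U ∧ #U ≤ τ ∧ ∀ T ⊆ U, #T < θ → Φ T ⊆ U := by
  have hτ : ℵ₀ ≤ τ := hθ.aleph0_le.trans hθτ
  let s : θ.ord.ToType → Set X := (wellFounded_lt (α := θ.ord.ToType)).fix
    fun i prev => S ∪ ⋃ j : Set.Iio i, (prev j j.2 ∪ Φ (prev j j.2))
  have hs : ∀ i, s i = S ∪ ⋃ j ∈ Set.Iio i, (s j ∪ Φ (s j)) := fun i => by
    rw [Set.biUnion_eq_iUnion]
    exact WellFounded.fix_eq _ _ i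
  have hsz : ∀ i, #(s i) ≤ τ := fun i => by
    induction i using WellFoundedLT.induction with
    | ind i ih =>
      rw [hs]
      exact mk_union_le_of_le hτ hS (mk_biUnion_le_of_forall_le hτ _ _
        ((mk_Iio_toType_ord_lt i).le.trans hθτ)
        fun j hj => mk_union_le_of_le hτ (ih j hj) (hsize _ (ih j hj)))
  have hstep : ∀ i j, i < j → s i ∪ Φ (s i) ⊆ s j := fun i j hij => by
    rw [hs j]
    exact (Set.subset_biUnion_of_mem (u := fun j => s j ∪ Φ (s j)) (show i ∈ Set.Iio j from hij)).trans
      Set.subset_union_right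
  -- By regularity, fewer than `θ` points all appear by some stage, and the next stage contains
  -- their image under `Φ`.
  have hub : ∀ t : Set θ.ord.ToType, #t < θ → ∃ b, ∀ a ∈ t, a < b := fun t ht => by
    by_contra! h
    have : IsCofinal t := h
    have := Order.cof_le this
    rw [Ordinal.cof_toType, hθ.cof_ord] at this
    exact this.not_gt ht
  refine ⟨⋃ i ∈ Set.univ, s i, ?_, mk_biUnion_le_of_forall_le hτ _ _ ?_ fun i _ => hsz i, ?_⟩
  · obtain ⟨b, -⟩ := hub ∅ (by simpa using hθ.pos)
    refine subset_trans ?_ (Set.subset_biUnion_of_mem (Set.mem_univ b))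
    rw [hs]
    exact Set.subset_union_left
  · simpa using hθτ
  · intro T hTU hT
    have : ∀ x : T, ∃ i, (x : X) ∈ s i := fun x => by simpa using hTU x.2
    choose i hi using this
    obtain ⟨b, hb⟩ := hub (Set.range i) (mk_range_le.trans_lt hT)
    obtain ⟨c, hc⟩ := hub {b} (by simpa using one_lt_aleph0.trans_le hθ.aleph0_le)
    have hTb : T ⊆ s b := fun x hx =>
      hstep _ _ (hb _ ⟨⟨x, hx⟩, rfl⟩) (Or.inl (hi ⟨x, hx⟩))
    refine ((hmono hTb).trans ?_).trans (Set.subset_biUnion_of_mem (Set.mem_univ c))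
    exact Set.subset_union_right.trans (hstep _ _ (hc b rfl))

/-- A set larger than `τ` is filtered by smaller closed sets, as soon as closed sets are preserved
by intersections and every small set has a small closed superset. -/
theorem exists_filtration {X : Type u} (D : Set X) {τ : Cardinal.{u}} (hτ : ℵ₀ ≤ τ) (hD : τ < #D)
    (Closed : Set X → Prop) (hInter : ∀ 𝒮 : Set (Set X), (∀ S ∈ 𝒮, Closed S) → Closed (⋂₀ 𝒮))
    (hcl : ∀ S : Set X, ∀ σ, τ ≤ σ → #S ≤ σ → ∃ Y, S ⊆ Y ∧ #Y ≤ σ ∧ Closed Y) :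
    ∃ (ι : Type u) (_ : LinearOrder ι) (_ : WellFoundedLT ι) (r : X → ι),
      ∀ α, ∃ Y, Closed Y ∧ #Y < #D ∧ ∀ x ∈ D, (r x ≤ α ↔ x ∈ Y) := by
  let ι := (#D).ord.ToType
  have : #D = #ι := (mk_ord_toType _).symm
  obtain ⟨e⟩ := Cardinal.eq.1 this
  have : Nonempty ι := mk_ne_zero_iff.1 (by
    rw [← this]; exact (aleph0_pos.trans_le (hτ.trans hD.le)).ne')
  let S : ι → Set X := fun α => (fun x : D => (x : X)) '' (e ⁻¹' Set.Iic α)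
  -- Taking the least closed superset makes `Y` monotone, so the first index at which a point
  -- appears serves as its rank. Continuity at limits is not needed.
  let Y : ι → Set X := fun α => ⋂₀ {Y | Closed Y ∧ S α ⊆ Y}
  have hSY : ∀ α, S α ⊆ Y α := fun α => Set.subset_sInter fun Y hY => hY.2
  have hYm : ∀ α β, α ≤ β → Y α ⊆ Y β := fun α β h =>
    Set.sInter_subset_sInter fun Z hZ => ⟨hZ.1, subset_trans
      (Set.image_mono (Set.preimage_mono (Set.Iic_subset_Iic.2 h))) hZ.2⟩
  have hYc : ∀ α, Closed (Y α) := fun α => hInter _ fun _ h => h.1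
  have hYs : ∀ α, #(Y α) < #D := fun α => by
    have h1 : #(S α) < #D := by
      refine mk_image_le.trans_lt ?_
      rw [mk_preimage_equiv, ← Set.Iio_insert]
      refine mk_insert_le.trans_lt (add_lt_of_lt (hτ.trans hD.le) (mk_Iio_toType_ord_lt α) ?_)
      exact one_lt_aleph0.trans_le (hτ.trans hD.le)
    obtain ⟨Z, hZ, hZs, hZc⟩ := hcl (S α) (max (#(S α)) τ) (le_max_right _ _) (le_max_left _ _)
    have hYZ : Y α ⊆ Z := Set.sInter_subset_of_mem ⟨hZc, hZ⟩
    exact ((mk_le_mk_of_subset hYZ).trans hZs).trans_lt (max_lt h1 hD)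
  have hex : ∀ x : X, ∃ a, x ∈ D → x ∈ Y a ∧ ∀ b, x ∈ Y b → a ≤ b := fun x => by
    by_cases hx : x ∈ D
    · have hne : {α | x ∈ Y α}.Nonempty := ⟨e ⟨x, hx⟩, hSY _ ⟨⟨x, hx⟩, Set.mem_preimage.2 (Set.mem_Iic.2 le_rfl), rfl⟩⟩
      exact ⟨wellFounded_lt.min _ hne, fun _ => ⟨wellFounded_lt.min_mem _ hne,
        fun b hb => not_lt.1 (wellFounded_lt.not_lt_min {α | x ∈ Y α} hb)⟩⟩
    · exact ⟨Classical.arbitrary _, fun h => absurd h hx⟩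
  choose r hr using hex
  exact ⟨ι, inferInstance, inferInstance, r, fun α => ⟨Y α, hYc α, hYs α, fun x hx =>
    ⟨fun h => hYm _ _ h (hr x hx).1, fun h => (hr x hx).2 α h⟩⟩⟩

/-- Every `μ`-almost disjoint indexed family of subsets of `X` of size `κ` is essentially
disjoint. -/
def IndexedED (X : Type u) (κ μ : Cardinal.{u}) : Prop :=
  ∀ (I : Type u) (A : I → Set X), (∀ i, #(A i) = κ) →
    (∀ i j, i ≠ j → #(A i ∩ A j : Set X) < μ) →
    ∃ F : I → Set X, (∀ i, F i ⊆ A i ∧ #(F i) < κ) ∧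
      ∀ i j, i ≠ j → Disjoint (A i \ F i) (A j \ F j)

theorem AlmostDisjointToED.indexedED {lam κ μ : Cardinal.{u}} (hμκ : μ ≤ κ)
    (h : AlmostDisjointToED lam κ μ) : IndexedED (CardSet lam) κ μ := by
  intro I A hA had
  have hinj : ∀ i j, i ≠ j → A i ≠ A j := fun i j hij he => by
    have := had i j hij
    rw [← he, Set.inter_self, hA] at this
    exact this.not_ge hμκ
  obtain ⟨F, hF, hd⟩ := h (Set.range A) (by rintro _ ⟨i, rfl⟩; exact hA i) (by
    rintro _ ⟨i, rfl⟩ _ ⟨j, rfl⟩ hij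
    exact had i j fun e => hij (e ▸ rfl))
  exact ⟨fun i => F (A i), fun i => hF _ ⟨i, rfl⟩,
    fun i j hij => hd _ ⟨i, rfl⟩ _ ⟨j, rfl⟩ (hinj i j hij)⟩

/-! ### Essential disjointness and the number of remainders through a point -/

section
variable {X I : Type u} {κ μ : Cardinal.{u}}

theorem diff_nonempty_of_mk_lt {A F : Set X} (hA : κ ≤ #A) (hF : #F < κ) : (A \ F).Nonempty := by
  by_contra h
  rw [Set.not_nonempty_iff_eq_empty, Set.sdiff_eq_empty] at h
  exact (mk_lt_of_subset h hF).not_ge hA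

/-- There are at most `#D` members of an almost disjoint family with a large trace on `D`. -/
theorem IndexedED.mk_le (hED : IndexedED X κ μ) (A : I → Set X)
    (had : ∀ i j, i ≠ j → #(A i ∩ A j : Set X) < μ) (D : Set X)
    (hA : ∀ i, κ ≤ #(A i ∩ D : Set X)) : #I ≤ #D := by
  choose B hBA hB using fun i => le_mk_iff_exists_subset.1 (hA i)
  obtain ⟨F, hF, hd⟩ := hED I B hB fun i j hij => mk_lt_of_subset
    (Set.inter_subset_inter ((hBA i).trans Set.inter_subset_left)
      ((hBA j).trans Set.inter_subset_left)) (had i j hij)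
  choose p hp using fun i => diff_nonempty_of_mk_lt (hB i).ge (hF i).2
  refine mk_le_of_injective (f := fun i => (⟨p i, (hBA i (hp i).1).2⟩ : D)) fun i j hij => ?_
  by_contra hne
  exact Set.disjoint_left.1 (hd i j hne) (hp i) (by
    rw [show p i = p j from congrArg Subtype.val hij]; exact hp j)

theorem IndexedED.mk_setOf_le (hED : IndexedED X κ μ) (A : I → Set X)
    (had : ∀ i j, i ≠ j → #(A i ∩ A j : Set X) < μ) (D : Set X) :
    #{i | κ ≤ #(A i ∩ D : Set X)} ≤ #D :=
  hED.mk_le (fun i : {i | κ ≤ #(A i ∩ D : Set X)} => A i)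
    (fun i j hij => had i j fun h => hij (Subtype.ext h)) D fun i => i.2

/-- Along a filtration, sets of size less than `κ` can be removed so that every point lies in at
most one remainder of a member that is still small when the point appears. -/
theorem IndexedED.exists_small_of_filtration (hED : IndexedED X κ μ) (hκ : ℵ₀ ≤ κ)
    (A : I → Set X) (had : ∀ i j, i ≠ j → #(A i ∩ A j : Set X) < μ)
    {ι : Type u} [LinearOrder ι] (r : X → ι) :
    ∃ F : I → Set X, (∀ i, F i ⊆ A i ∧ #(F i) < κ) ∧
      ∀ x i j, x ∈ A i \ F i → x ∈ A j \ F j → #(A i ∩ {y | r y ≤ r x} : Set X) < κ →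
        #(A j ∩ {y | r y ≤ r x} : Set X) < κ → i = j := by
  classical
  let B : I → Set X := fun i => {x | x ∈ A i ∧ #(A i ∩ {y | r y ≤ r x} : Set X) < κ}
  have hBA : ∀ i, B i ⊆ A i := fun i x hx => hx.1
  have hB : ∀ i, #(B i) ≤ κ := fun i =>
    mk_le_of_initial_segments_lt r hκ (B i) fun x hx =>
      mk_lt_of_subset (T := A i ∩ {y | r y ≤ r x}) (fun y hy => ⟨hy.1.1, hy.2⟩) hx.2
  obtain ⟨F, hF, hd⟩ := hED {i | #(B i) = κ} (fun i => B i) (fun i => i.2) fun i j hij =>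
    mk_lt_of_subset (Set.inter_subset_inter (hBA i) (hBA j))
      (had i j fun h => hij (Subtype.ext h))
  -- A set `B i` of size below `κ` is not covered by the hypothesis, but can be removed whole.
  refine ⟨fun i => if h : #(B i) = κ then F ⟨i, h⟩ else B i, fun i => ?_, ?_⟩
  · by_cases h : #(B i) = κ
    · simp only [h, dif_pos]
      exact ⟨(hF ⟨i, h⟩).1.trans (hBA i), (hF ⟨i, h⟩).2⟩
    · simp only [h, dif_neg, not_false_iff]
      exact ⟨hBA i, (hB i).lt_of_ne h⟩
  · intro x i j hi hj hi' hj'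
    have key : ∀ i, (x ∈ A i \ if h : #(B i) = κ then F ⟨i, h⟩ else B i) →
        #(A i ∩ {y | r y ≤ r x} : Set X) < κ → ∃ h : #(B i) = κ, x ∈ B i \ F ⟨i, h⟩ := by
      intro i hi hs
      by_cases h : #(B i) = κ
      · rw [dif_pos h] at hi
        exact ⟨h, ⟨hi.1, hs⟩, hi.2⟩
      · rw [dif_neg h] at hi
        exact absurd ⟨hi.1, hs⟩ hi.2
    obtain ⟨h1, h1'⟩ := key i hi hi'
    obtain ⟨h2, h2'⟩ := key j hj hj'
    by_contra hne
    exact Set.disjoint_left.1 (hd ⟨i, h1⟩ ⟨j, h2⟩ fun h => hne (congrArg Subtype.val h)) h1' h2'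

/-- The sets that contain the intersection of any two members of the family having a large trace
on them. -/
def LargeTraceClosed (κ : Cardinal.{u}) (A : I → Set X) (Y : Set X) : Prop :=
  ∀ i j, i ≠ j → κ ≤ #(A i ∩ Y : Set X) → κ ≤ #(A j ∩ Y : Set X) → A i ∩ A j ⊆ Y

theorem LargeTraceClosed.sInter (A : I → Set X) (𝒮 : Set (Set X))
    (h : ∀ S ∈ 𝒮, LargeTraceClosed κ A S) : LargeTraceClosed κ A (⋂₀ 𝒮) :=
  fun i j hij hi hj => Set.subset_sInter fun S hS => h S hS i j hij
    (le_mk_of_subset (Set.inter_subset_inter_right _ (Set.sInter_subset_of_mem hS)) hi)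
    (le_mk_of_subset (Set.inter_subset_inter_right _ (Set.sInter_subset_of_mem hS)) hj)

/-- A large trace is already witnessed by `κ` points, so closing under sets of size below the
regular cardinal `succ κ` suffices. This is what forces `succ κ ≤ σ`. By `IndexedED.mk_setOf_le`
each step adds only `σ` points. -/
theorem IndexedED.exists_largeTraceClosed (hED : IndexedED X κ μ) (hκ : ℵ₀ ≤ κ) (hμκ : μ ≤ κ)
    (A : I → Set X) (had : ∀ i j, i ≠ j → #(A i ∩ A j : Set X) < μ)
    (S : Set X) (σ : Cardinal.{u}) (hσ : Order.succ κ ≤ σ) (hS : #S ≤ σ) :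
    ∃ Y, S ⊆ Y ∧ #Y ≤ σ ∧ LargeTraceClosed κ A Y := by
  have hκσ : κ ≤ σ := (Order.le_succ κ).trans hσ
  have hσ0 : ℵ₀ ≤ σ := hκ.trans hκσ
  let H : Set X → Set I := fun S => {i | κ ≤ #(A i ∩ S : Set X)}
  let Φ : Set X → Set X := fun S => ⋃ i ∈ H S, ⋃ j ∈ H S \ {i}, A i ∩ A j
  have hHm : Monotone H := fun S T hST i hi =>
    le_mk_of_subset (Set.inter_subset_inter_right _ hST) hi
  obtain ⟨U, hSU, hU, hcl⟩ := exists_closed_superset (isRegular_succ hκ) hσ Φ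
    (fun S T hST => Set.biUnion_mono (hHm hST) fun i _ =>
      Set.biUnion_mono (Set.sdiff_subset_sdiff_left (hHm hST)) fun j _ => subset_rfl)
    (fun S hS => by
      have hH : #(H S) ≤ σ := (hED.mk_setOf_le A had S).trans hS
      refine mk_biUnion_le_of_forall_le hσ0 _ _ hH fun i _ => mk_biUnion_le_of_forall_le hσ0 _ _
        ((mk_le_mk_of_subset Set.sdiff_subset).trans hH) fun j hj => ?_
      exact ((had i j fun h => hj.2 h.symm).le.trans hμκ).trans hκσ) S hS
  refine ⟨U, hSU, hU, fun i j hij hi hj => ?_⟩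
  obtain ⟨S₁, hS₁, h₁⟩ := le_mk_iff_exists_subset.1 hi
  obtain ⟨S₂, hS₂, h₂⟩ := le_mk_iff_exists_subset.1 hj
  have hi' : i ∈ H (S₁ ∪ S₂) := le_mk_of_subset
    (fun x hx => ⟨(hS₁ hx).1, Or.inl hx⟩) h₁.ge
  have hj' : j ∈ H (S₁ ∪ S₂) := le_mk_of_subset
    (fun x hx => ⟨(hS₂ hx).1, Or.inr hx⟩) h₂.ge
  refine subset_trans ?_ (hcl (S₁ ∪ S₂) (Set.union_subset
    (hS₁.trans Set.inter_subset_right) (hS₂.trans Set.inter_subset_right))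
    ((mk_union_le_of_le hκ h₁.le h₂.le).trans_lt (Order.lt_succ κ)))
  intro x hx
  exact Set.mem_biUnion hi' (Set.mem_biUnion (show j ∈ H _ \ {i} from ⟨hj', fun h => hij h.symm⟩) hx)

/-- From the members of an almost disjoint family of large sets one can remove fewer than `κ`
points so that each point lies in at most `κ` of the remainders. -/
theorem IndexedED.exists_essentially_le_to_one (hED : IndexedED X κ μ) (hκ : ℵ₀ ≤ κ)
    (hμκ : μ ≤ κ) (D : Set X) (A : I → Set X) (hAD : ∀ i, A i ⊆ D) (hA : ∀ i, κ ≤ #(A i))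
    (had : ∀ i j, i ≠ j → #(A i ∩ A j : Set X) < μ) :
    ∃ F : I → Set X, (∀ i, F i ⊆ A i ∧ #(F i) < κ) ∧ ∀ x, #{i | x ∈ A i \ F i} ≤ κ := by
  induction hν : #D using WellFoundedLT.induction generalizing D I with
  | ind ν ih =>
  subst hν
  have hsub : ∀ s : Set I, s.Subsingleton → #s ≤ κ := fun s hs =>
    (mk_le_one_iff_set_subsingleton.2 hs).trans (one_le_aleph0.trans hκ)
  rcases le_or_gt #D κ with hD | hD
  · refine ⟨fun _ => ∅, fun i => ⟨Set.empty_subset _, ?_⟩, fun x => ?_⟩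
    · simpa using aleph0_pos.trans_le hκ
    · exact ((mk_set_le _).trans (hED.mk_le A had D fun i => by
        rw [Set.inter_eq_left.2 (hAD i)]; exact hA i)).trans hD
  rcases le_or_gt #D (Order.succ κ) with hD' | hD'
  -- Here closed hulls of size `κ` are unavailable, but initial parts have size at most `κ`, so at
  -- most `κ` members have a large trace on each.
  · obtain ⟨ι, _, _, r, hr⟩ := exists_filtration D hκ hD (fun _ => True) (fun _ _ => trivial)
      fun S σ _ hS => ⟨S, subset_rfl, hS, trivial⟩
    obtain ⟨F, hF, hF'⟩ := hED.exists_small_of_filtration hκ A had r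
    refine ⟨F, hF, fun x => ?_⟩
    have hx : #(D ∩ {y | r y ≤ r x} : Set X) ≤ κ := by
      obtain ⟨Y, -, hY, h⟩ := hr (r x)
      exact (mk_le_mk_of_subset fun y hy => (h y hy.1).1 hy.2).trans
        (Order.lt_succ_iff.1 (hY.trans_le hD'))
    refine (mk_le_mk_of_subset (t := {i | x ∈ A i \ F i ∧ #(A i ∩ {y | r y ≤ r x} : Set X) < κ} ∪
      {i | κ ≤ #(A i ∩ (D ∩ {y | r y ≤ r x}) : Set X)}) fun i hi => ?_).trans
      (mk_union_le_of_le hκ (hsub _ fun i hi j hj => hF' x i j hi.1 hj.1 hi.2 hj.2)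
        ((hED.mk_setOf_le A had _).trans hx))
    rcases lt_or_ge #(A i ∩ {y | r y ≤ r x} : Set X) κ with h | h
    · exact Or.inl ⟨hi, h⟩
    · exact Or.inr (le_mk_of_subset (fun y hy => ⟨hy.1, hAD i hy.1, hy.2⟩) h)
  · obtain ⟨ι, _, _, r, hr⟩ := exists_filtration D (hκ.trans (Order.le_succ κ)) hD'
      (LargeTraceClosed κ A) (LargeTraceClosed.sInter A)
      (hED.exists_largeTraceClosed hκ hμκ A had)
    obtain ⟨F₁, hF₁, hF₁'⟩ := hED.exists_small_of_filtration hκ A had r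
    -- The members through `x` split by whether their trace becomes large after, at, or before the
    -- rank of `x`. The first and last kinds contribute at most one each; the middle kind is handled
    -- by induction on the slice.
    let First : I → ι → Prop := fun i α => κ ≤ #(A i ∩ {y | r y ≤ α} : Set X) ∧
      ∀ β < α, #(A i ∩ {y | r y ≤ β} : Set X) < κ
    have hFirst : ∀ i α β, First i α → First i β → α = β := fun i α β h h' => by
      rcases lt_trichotomy α β with hl | rfl | hl
      · exact absurd h.1 (h'.2 _ hl).not_ge
      · rfl
      · exact absurd h'.1 (h.2 _ hl).not_ge
    have hG : ∀ α, ∃ G : I → Set X, (∀ i, G i ⊆ A i ∧ #(G i) < κ) ∧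
        ∀ x, r x = α → #{i | First i α ∧ x ∈ A i \ G i} ≤ κ := by
      intro α
      let J : Set I := {i | First i α ∧ κ ≤ #(A i ∩ {y | r y = α} : Set X)}
      obtain ⟨Y, -, hY, hYr⟩ := hr α
      obtain ⟨G, hG, hG'⟩ := ih #(D ∩ {y | r y = α} : Set X)
        ((mk_le_mk_of_subset fun y hy => (hYr y hy.1).1 (le_of_eq hy.2)).trans_lt hY)
        (D ∩ {y | r y = α}) (fun i : J => A i ∩ {y | r y = α})
        (fun i => Set.inter_subset_inter_left _ (hAD i)) (fun i => i.2.2)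
        (fun i j hij => mk_lt_of_subset (Set.inter_subset_inter Set.inter_subset_left
          Set.inter_subset_left) (had i j fun h => hij (Subtype.ext h))) rfl
      classical
      -- A member can first become large at `α` with a small trace on the slice itself; that trace
      -- is removed whole.
      refine ⟨fun i => if h : i ∈ J then G ⟨i, h⟩ else
        if κ ≤ #(A i ∩ {y | r y = α} : Set X) then ∅ else A i ∩ {y | r y = α}, fun i => ?_, ?_⟩
      · by_cases h : i ∈ J
        · simp only [h, dif_pos]
          exact ⟨(hG ⟨i, h⟩).1.trans Set.inter_subset_left, (hG ⟨i, h⟩).2⟩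
        · beta_reduce
          rw [dif_neg h]
          split_ifs with h'
          · exact ⟨Set.empty_subset _, by simpa using aleph0_pos.trans_le hκ⟩
          · exact ⟨Set.inter_subset_left, not_le.1 h'⟩
      · intro x hx
        refine (mk_le_mk_of_subset (t := Subtype.val '' {i : J | x ∈ (A i ∩ {y | r y = α}) \ G i})
          ?_).trans (mk_image_le.trans (hG' x))
        rintro i ⟨hi, hxA, hxG⟩
        beta_reduce at hxG
        by_cases h : i ∈ J
        · rw [dif_pos h] at hxG
          exact ⟨⟨i, h⟩, ⟨⟨hxA, hx⟩, hxG⟩, rfl⟩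
        · rw [dif_neg h, if_neg fun h' => h ⟨hi, h'⟩] at hxG
          exact absurd ⟨hxA, hx⟩ hxG
    choose G hG hG' using hG
    refine ⟨fun i => F₁ i ∪ {x | First i (r x) ∧ x ∈ G (r x) i}, fun i => ⟨Set.union_subset
      (hF₁ i).1 fun x hx => (hG _ i).1 hx.2, mk_union_lt_of_lt hκ (hF₁ i).2 ?_⟩, fun x => ?_⟩
    · by_cases h : ∃ α, First i α
      · obtain ⟨α, hα⟩ := h
        refine mk_lt_of_subset ?_ (hG α i).2
        rintro x ⟨hx, hx'⟩
        rwa [hFirst i _ _ hα hx]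
      · rw [Set.eq_empty_of_forall_notMem fun x (hx : x ∈ {x | First i (r x) ∧ x ∈ G (r x) i}) =>
          h ⟨_, hx.1⟩]
        simpa using aleph0_pos.trans_le hκ
    · refine (mk_le_mk_of_subset
        (t := ({i | x ∈ A i \ F₁ i ∧ #(A i ∩ {y | r y ≤ r x} : Set X) < κ} ∪
          {i | First i (r x) ∧ x ∈ A i \ G (r x) i}) ∪
          {i | x ∈ A i ∧ ∃ β < r x, κ ≤ #(A i ∩ {y | r y ≤ β} : Set X)}) ?_).trans
        (mk_union_le_of_le hκ (mk_union_le_of_le hκ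
          (hsub _ fun i hi j hj => hF₁' x i j hi.1 hj.1 hi.2 hj.2) (hG' _ x rfl)) (hsub _ ?_))
      · rintro i ⟨hi, hi'⟩
        by_cases h1 : #(A i ∩ {y | r y ≤ r x} : Set X) < κ
        · exact Or.inl (Or.inl ⟨⟨hi, fun h => hi' (Or.inl h)⟩, h1⟩)
        by_cases h2 : ∃ β < r x, κ ≤ #(A i ∩ {y | r y ≤ β} : Set X)
        · exact Or.inr ⟨hi, h2⟩
        · push Not at h1 h2
          exact Or.inl (Or.inr ⟨⟨h1, h2⟩, hi, fun h => hi' (Or.inr ⟨⟨h1, h2⟩, h⟩)⟩)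
      · rintro i ⟨hi, β, hβ, hβ'⟩ j ⟨hj, γ, hγ, hγ'⟩
        by_contra hij
        obtain ⟨Y, hY, -, hYr⟩ := hr (max β γ)
        have : x ∈ Y := hY i j hij
          (le_mk_of_subset (fun y hy => ⟨hy.1, (hYr y (hAD i hy.1)).1
            (le_trans hy.2 (le_max_left _ _))⟩) hβ')
          (le_mk_of_subset (fun y hy => ⟨hy.1, (hYr y (hAD j hy.1)).1
            (le_trans hy.2 (le_max_right _ _))⟩) hγ') ⟨hi, hj⟩
        exact ((hYr x (hAD i hi)).2 this).not_gt (max_lt hβ hγ)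
end

/-! ### Stages and the inductive coloring -/

section
variable {X I C : Type u} {κ μ : Cardinal.{u}}

/-- `T` consists of at least `κ` pairs with distinct first coordinates, each of which is the color
of exactly one point of `A`. -/
def IsUniqueTransversal (κ : Cardinal.{u}) (f : X → C × C) (A : Set X) (T : Set (C × C)) : Prop :=
  T.InjOn Prod.fst ∧ κ ≤ #T ∧ ∀ c ∈ T, ∃! x, x ∈ A ∧ f x = c

/-- The sets `Y` that contain `G i` whenever they meet `B i`, and `A i ∩ A j` whenever they meet
`B i` and `B j`. -/
def TraceClosed (A B G : I → Set X) (Y : Set X) : Prop :=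
  (∀ i, (B i ∩ Y).Nonempty → G i ⊆ Y) ∧
    ∀ i j, i ≠ j → (B i ∩ Y).Nonempty → (B j ∩ Y).Nonempty → A i ∩ A j ⊆ Y

theorem TraceClosed.sInter (A B G : I → Set X) (𝒮 : Set (Set X))
    (h : ∀ S ∈ 𝒮, TraceClosed A B G S) : TraceClosed A B G (⋂₀ 𝒮) := by
  have hm : ∀ S ∈ 𝒮, ∀ i, (B i ∩ ⋂₀ 𝒮).Nonempty → (B i ∩ S).Nonempty := fun S hS i hi =>
    hi.mono (Set.inter_subset_inter_right _ (Set.sInter_subset_of_mem hS))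
  exact ⟨fun i hi => Set.subset_sInter fun S hS => (h S hS).1 i (hm S hS i hi),
    fun i j hij hi hj => Set.subset_sInter fun S hS =>
      (h S hS).2 i j hij (hm S hS i hi) (hm S hS j hj)⟩

/-- Each closure condition is triggered by at most two points, so closing under finite sets is
enough, and the hull may have size `κ`. -/
theorem exists_traceClosed (hκ : ℵ₀ ≤ κ) (A B G : I → Set X) (hB : ∀ x, #{i | x ∈ B i} ≤ κ)
    (hG : ∀ i, #(G i) ≤ κ) (had : ∀ i j, i ≠ j → #(A i ∩ A j : Set X) ≤ κ)
    (S : Set X) (σ : Cardinal.{u}) (hσ : κ ≤ σ) (hS : #S ≤ σ) :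
    ∃ Y, S ⊆ Y ∧ #Y ≤ σ ∧ TraceClosed A B G Y := by
  have hσ0 : ℵ₀ ≤ σ := hκ.trans hσ
  let H : Set X → Set I := fun S => {i | (B i ∩ S).Nonempty}
  let Φ : Set X → Set X := fun S => ⋃ i ∈ H S, (G i ∪ ⋃ j ∈ H S \ {i}, A i ∩ A j)
  have hHm : Monotone H := fun S T hST i hi => hi.mono (Set.inter_subset_inter_right _ hST)
  obtain ⟨U, hSU, hU, hcl⟩ := exists_closed_superset isRegular_aleph0 hσ0 Φ
    (fun S T hST => Set.biUnion_mono (hHm hST) fun i _ => Set.union_subset_union_right _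
      (Set.biUnion_mono (Set.sdiff_subset_sdiff_left (hHm hST)) fun j _ => subset_rfl))
    (fun S hS => by
      have hH : #(H S) ≤ σ := by
        refine (mk_le_mk_of_subset (t := ⋃ x ∈ S, {i | x ∈ B i}) ?_).trans
          (mk_biUnion_le_of_forall_le hσ0 _ _ hS fun x _ => (hB x).trans hσ)
        rintro i ⟨x, hx, hxS⟩
        exact Set.mem_biUnion hxS hx
      refine mk_biUnion_le_of_forall_le hσ0 _ _ hH fun i _ => mk_union_le_of_le hσ0
        ((hG i).trans hσ) (mk_biUnion_le_of_forall_le hσ0 _ _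
          ((mk_le_mk_of_subset Set.sdiff_subset).trans hH) fun j hj => ?_)
      exact (had i j fun h => hj.2 h.symm).trans hσ) S hS
  refine ⟨U, hSU, hU, ?_, ?_⟩
  · rintro i ⟨x, hx, hxU⟩
    refine subset_trans (fun y hy => ?_) (hcl {x} (by simpa using hxU) (by simp))
    exact Set.mem_biUnion (show i ∈ H _ from ⟨x, hx, rfl⟩) (Or.inl hy)
  · rintro i j hij ⟨x, hx, hxU⟩ ⟨y, hy, hyU⟩
    refine subset_trans (fun z hz => ?_) (hcl {x, y} (by
      rintro z (rfl | rfl) <;> assumption) ((Set.toFinite _).lt_aleph0))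
    exact Set.mem_biUnion (show i ∈ H _ from ⟨x, hx, Or.inl rfl⟩) (Or.inr
      (Set.mem_biUnion (show j ∈ H _ \ {i} from ⟨⟨y, hy, Or.inr rfl⟩, fun h => hij h.symm⟩) hz))

/-- A filtration along which every member of the family acquires a large trace at a single stage,
and any point of a later stage lies in at most one such member. -/
theorem IndexedED.exists_stages (hED : IndexedED X κ μ) (hκ : ℵ₀ ≤ κ) (hμκ : μ ≤ κ)
    (D : Set X) (hD : κ < #D) (A : I → Set X) (hAD : ∀ i, A i ⊆ D) (hA : ∀ i, κ ≤ #(A i))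
    (had : ∀ i j, i ≠ j → #(A i ∩ A j : Set X) < μ) :
    ∃ (ι : Type u) (_ : LinearOrder ι) (_ : WellFoundedLT ι) (r : X → ι) (s : I → ι),
      (∀ α, #(D ∩ {x | r x = α} : Set X) < #D) ∧
      (∀ i, κ ≤ #(A i ∩ {x | r x = s i} : Set X)) ∧
      (∀ i, #(A i ∩ {x | r x < s i} : Set X) < κ) ∧
      ∀ i j x, x ∈ A i → x ∈ A j → s i < r x → s j < r x → i = j := by
  obtain ⟨F, hF, hF'⟩ := hED.exists_essentially_le_to_one hκ hμκ D A hAD hA had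
  choose G hGA hG using fun i => le_mk_iff_exists_subset.1 (hA i)
  obtain ⟨ι, _, _, r, hr⟩ := exists_filtration D hκ hD (TraceClosed A (fun i => A i \ F i) G)
    (TraceClosed.sInter A _ G) (exists_traceClosed hκ A _ G hF' (fun i => (hG i).le)
      fun i j hij => (had i j hij).le.trans hμκ)
  have hmin : ∀ i, ∃ x, x ∈ A i \ F i ∧ ∀ y ∈ A i \ F i, r x ≤ r y := fun i => by
    have hne := (diff_nonempty_of_mk_lt (hA i) (hF i).2).image r
    obtain ⟨x, hx, hx'⟩ := wellFounded_lt.min_mem _ hne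
    exact ⟨x, hx, fun y hy => hx' ▸ not_lt.1
      (wellFounded_lt.not_lt_min (r '' (A i \ F i)) ⟨y, hy, rfl⟩)⟩
  -- The stage of a member is the least rank in its remainder, so everything earlier lies in `F i`.
  choose p hp hp' using hmin
  have hlt : ∀ i, A i ∩ {x | r x < r (p i)} ⊆ F i := fun i x hx => by
    by_contra h
    exact (hp' i x ⟨hx.1, h⟩).not_gt hx.2
  refine ⟨ι, inferInstance, inferInstance, r, fun i => r (p i), fun α => ?_, fun i => ?_,
    fun i => mk_lt_of_subset (hlt i) (hF i).2, fun i j x hi hj hsi hsj => ?_⟩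
  · obtain ⟨Y, -, hY, h⟩ := hr α
    exact mk_lt_of_subset (fun x hx => (h x hx.1).1 (le_of_eq hx.2)) hY
  · obtain ⟨Y, hY, -, h⟩ := hr (r (p i))
    have hGY := hY.1 i ⟨p i, hp i, (h _ (hAD i (hp i).1)).1 le_rfl⟩
    refine le_mk_of_subset_union hκ (hG i).ge (fun x hx => ?_) (hF i).2
    rcases ((h x (hAD i (hGA i hx))).2 (hGY hx)).eq_or_lt with h | h
    · exact Or.inl ⟨hGA i hx, h⟩
    · exact Or.inr (hlt i ⟨hGA i hx, h⟩)
  · by_contra hij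
    obtain ⟨Y, hY, -, h⟩ := hr (max (r (p i)) (r (p j)))
    have := hY.2 i j hij ⟨p i, hp i, (h _ (hAD i (hp i).1)).1 (le_max_left _ _)⟩
      ⟨p j, hp j, (h _ (hAD j (hp j).1)).1 (le_max_right _ _)⟩ ⟨hi, hj⟩
    exact ((h x (hAD i hi)).2 this).not_gt (max_lt hsi hsj)

/-- The colorings by pairs in which every member of an almost disjoint family of large sets has
`κ` unique colors exist, even when every point `x` is to avoid a set `J x` of colors meeting every
column in a finite set. -/
theorem IndexedED.exists_coloring (hED : IndexedED X κ μ) (hκ : ℵ₀ ≤ κ) (hμκ : μ ≤ κ)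
    (hC : #C = κ) (D : Set X) (A : I → Set X) (hAD : ∀ i, A i ⊆ D) (hA : ∀ i, κ ≤ #(A i))
    (had : ∀ i j, i ≠ j → #(A i ∩ A j : Set X) < μ)
    (J : X → Set (C × C)) (hJ : ∀ x c, {d | (c, d) ∈ J x}.Finite) :
    ∃ f : X → C × C, (∀ x ∈ D, f x ∉ J x) ∧ ∀ i, ∃ T, IsUniqueTransversal κ f (A i) T := by
  classical
  induction hν : #D using WellFoundedLT.induction generalizing D I J with
  | ind ν ih =>
  subst hν
  have : Infinite C := infinite_iff.2 (hC ▸ hκ)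
  rcases le_or_gt #D κ with hD | hD
  · obtain ⟨e⟩ : Nonempty (D ↪ C) := by rwa [← Cardinal.le_def, hC]
    choose d hd using fun x c => (hJ x c).exists_notMem
    let f : X → C × C := fun x => if h : x ∈ D then (e ⟨x, h⟩, d x (e ⟨x, h⟩)) else
      Classical.arbitrary _
    have hf : ∀ x (h : x ∈ D), f x = (e ⟨x, h⟩, d x (e ⟨x, h⟩)) := fun x h => dif_pos h
    have hinj : ∀ x ∈ D, ∀ y ∈ D, (f x).1 = (f y).1 → x = y := fun x hx y hy h => by
      rw [hf x hx, hf y hy] at h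
      exact congrArg Subtype.val (e.injective h)
    refine ⟨f, fun x hx h => ?_, fun i => ⟨f '' A i, ?_, ?_, ?_⟩⟩
    · rw [hf x hx] at h
      exact hd _ _ h
    · rintro _ ⟨x, hx, rfl⟩ _ ⟨y, hy, rfl⟩ h
      rw [hinj x (hAD i hx) y (hAD i hy) h]
    · rw [mk_image_eq_of_injOn f (A i) fun x hx y hy h =>
        hinj x (hAD i hx) y (hAD i hy) (congrArg Prod.fst h)]
      exact hA i
    · rintro _ ⟨x, hx, rfl⟩
      exact ⟨x, ⟨hx, rfl⟩, fun y hy =>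
        hinj y (hAD i hy.1) x (hAD i hx) (congrArg Prod.fst hy.2)⟩
  obtain ⟨ι, _, _, r, s, hr, hs, hlt, huniq⟩ := hED.exists_stages hκ hμκ D hD A hAD hA had
  -- Injectivity is kept unconditional: it is what proves, after the recursion is defined, that the
  -- forbidden sets are finite in columns, as the other clause requires.
  have hstage : ∀ α, ∀ J : X → Set (C × C), ∃ p : (X → C × C) × (I → Set (C × C)),
      (∀ i, (p.2 i).InjOn Prod.fst) ∧ ((∀ x c, {d | (c, d) ∈ J x}.Finite) →
        (∀ x ∈ D, r x = α → p.1 x ∉ J x) ∧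
        ∀ i, s i = α → IsUniqueTransversal κ p.1 (A i ∩ {x | r x = α}) (p.2 i)) := by
    intro α J
    by_cases hJ : ∀ x c, {d | (c, d) ∈ J x}.Finite
    · obtain ⟨f, hf, hT⟩ := ih #(D ∩ {x | r x = α} : Set X) (hr α) (D ∩ {x | r x = α})
        (fun i : {i | s i = α} => A i ∩ {x | r x = α})
        (fun i => Set.inter_subset_inter_left _ (hAD i)) (fun i => by
          obtain ⟨i, rfl⟩ := i; exact hs i)
        (fun i j hij => mk_lt_of_subset (Set.inter_subset_inter Set.inter_subset_left
          Set.inter_subset_left) (had i j fun h => hij (Subtype.ext h))) J hJ rfl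
      choose T hT using hT
      refine ⟨(f, fun i => if h : s i = α then T ⟨i, h⟩ else ∅), fun i => ?_, fun _ =>
        ⟨fun x hx hxα => hf x ⟨hx, hxα⟩, fun i hi => ?_⟩⟩
      · by_cases h : s i = α
        · simp only [h, dif_pos]
          exact (hT ⟨i, h⟩).1
        · simp [h]
      · simp only [hi, dif_pos]
        exact hT ⟨i, hi⟩
    · exact ⟨(fun _ => Classical.arbitrary _, fun _ => ∅), fun i => by simp, fun h => absurd h hJ⟩
  choose Φ hΦ hΦ' using hstage
  let g : ι → (X → C × C) × (I → Set (C × C)) := (wellFounded_lt (α := ι)).fix fun α prev =>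
    Φ α fun x => J x ∪ {c | r x = α ∧ ∃ i, ∃ h : s i < α, x ∈ A i ∧ c ∈ (prev (s i) h).2 i}
  let J' : ι → X → Set (C × C) := fun α x =>
    J x ∪ {c | r x = α ∧ ∃ i, ∃ _ : s i < α, x ∈ A i ∧ c ∈ (g (s i)).2 i}
  have hg : ∀ α, g α = Φ α (J' α) := fun α => WellFounded.fix_eq _ _ α
  have hgT : ∀ α i, ((g α).2 i).InjOn Prod.fst := fun α i => by
    rw [hg]
    exact hΦ _ _ i
  have hJ' : ∀ α x c, {d | (c, d) ∈ J' α x}.Finite := fun α x c => by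
    refine (hJ x c).union (Set.Subsingleton.finite ?_)
    rintro d ⟨rfl, i, hi, hxi, hd⟩ d' ⟨-, j, hj, hxj, hd'⟩
    obtain rfl := huniq i j x hxi hxj hi hj
    exact congrArg Prod.snd (hgT _ _ hd hd' rfl)
  have hgood := fun α => hΦ' α (J' α) (hJ' α)
  simp only [← hg] at hgood
  let f : X → C × C := fun x => (g (r x)).1 x
  have hf : ∀ x ∈ D, f x ∉ J' (r x) x := fun x hx => (hgood (r x)).1 x hx rfl
  refine ⟨f, fun x hx h => hf x hx (Or.inl h), fun i => ?_⟩
  obtain ⟨-, hT, hT'⟩ := (hgood (s i)).2 i rfl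
  refine ⟨(g (s i)).2 i \ f '' (A i ∩ {x | r x < s i}), (hgT _ _).mono Set.sdiff_subset,
    le_mk_of_subset_union (T := f '' (A i ∩ {x | r x < s i})) hκ hT (fun c hc => ?_) (mk_image_le.trans_lt (hlt i)), ?_⟩
  · rw [Set.sdiff_union_self]
    exact Or.inl hc
  · rintro c ⟨hc, hc'⟩
    obtain ⟨x, ⟨⟨hxA, hxr⟩, hxc⟩, hx⟩ := hT' c hc
    have hxr : r x = s i := hxr
    refine ⟨x, ⟨hxA, by rw [← hxc, ← hxr]⟩, ?_⟩
    rintro y ⟨hyA, rfl⟩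
    rcases lt_trichotomy (r y) (s i) with h | h | h
    · exact absurd ⟨y, ⟨hyA, h⟩, rfl⟩ hc'
    · exact hx y ⟨⟨hyA, h⟩, by rw [← h]⟩
    · exact absurd (Or.inr ⟨rfl, i, h, hyA, hc⟩) (hf y (hAD i hyA))
end

/-! ### From pairs of colors to `κ` colors -/

theorem mem_uniqueColors_iff {D C : Type u} {f : D → C} {A : Set D} {ξ : C} :
    ξ ∈ uniqueColors f A ↔ ∃! x, x ∈ A ∧ f x = ξ := by
  have : #(A ∩ f ⁻¹' {ξ} : Set D) = 1 ↔ ∃! x, x ∈ A ∧ f x = ξ := by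
    rw [mk_set_eq_one_iff]
    exact exists_congr fun x => Set.eq_singleton_iff_unique_mem
  refine ⟨fun h => this.1 h.2, fun h => ⟨?_, this.2 h⟩⟩
  obtain ⟨x, hx, -⟩ := h
  exact ⟨x, hx.2⟩

theorem AlmostDisjointToED.exists_coloring {μ κ lam : Cardinal.{u}} (hμκ : μ ≤ κ) (hκ : ℵ₀ ≤ κ)
    (hED : AlmostDisjointToED lam κ μ) (𝒜 : Set (Set (CardSet lam)))
    (h𝒜 : 𝒜 ⊆ setsOfCardGE (CardSet lam) κ) (had : AlmostDisjointFamily μ 𝒜) :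
    ∃ f : CardSet lam → CardSet κ, ∀ A ∈ 𝒜, #(uniqueColors f A) = κ := by
  have hC : #(CardSet κ) = κ := mk_ord_toType κ
  obtain ⟨f, -, hf⟩ := (hED.indexedED hμκ).exists_coloring hκ hμκ hC Set.univ
    (fun A : 𝒜 => (A : Set (CardSet lam))) (fun A => Set.subset_univ _) (fun A => h𝒜 A.2)
    (fun A B hAB => had A A.2 B B.2 fun h => hAB (Subtype.ext h)) (fun _ => ∅) (by simp)
  obtain ⟨e⟩ : Nonempty (CardSet κ × CardSet κ ≃ CardSet κ) := by
    rw [← Cardinal.eq, mk_prod, lift_id, hC, mul_eq_self hκ]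
  refine ⟨e ∘ f, fun A hA => le_antisymm ((mk_set_le _).trans hC.le) ?_⟩
  obtain ⟨T, -, hT, hT'⟩ := hf ⟨A, hA⟩
  refine (hT.trans (mk_image_eq e.injective).ge).trans (mk_le_mk_of_subset ?_)
  rintro _ ⟨c, hc, rfl⟩
  rw [mem_uniqueColors_iff]
  simpa using hT' c hc

theorem corollary4p2 (μ κ lam : Cardinal.{u}) (hμκ : μ ≤ κ) (hκlam : κ ≤ lam) (hκ : ℵ₀ ≤ κ)
    (hED : AlmostDisjointToED lam κ μ) :
    (∀ 𝒜 : Set (Set (CardSet lam)), 𝒜 ⊆ setsOfCardGE (CardSet lam) κ →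
      AlmostDisjointFamily μ 𝒜 →
        ∃ f : CardSet lam → CardSet κ, ∀ A ∈ 𝒜, #(uniqueColors f A) = κ) ∧
    CFGE lam κ μ κ := by
  refine ⟨fun 𝒜 h𝒜 had => hED.exists_coloring hμκ hκ 𝒜 h𝒜 had, fun 𝒜 h𝒜 had => ?_⟩
  obtain ⟨f, hf⟩ := hED.exists_coloring hμκ hκ 𝒜 h𝒜 had
  refine ⟨fun x => f x, fun A hA => ?_⟩
  obtain ⟨ξ, hξ⟩ : (uniqueColors f A).Nonempty := by
    rw [← Set.nonempty_coe_sort, ← mk_ne_zero_iff, hf A hA]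
    exact (aleph0_pos.trans_le hκ).ne'
  obtain ⟨x, ⟨hxA, hxξ⟩, hx⟩ := mem_uniqueColors_iff.1 hξ
  exact ⟨ξ, mem_uniqueColors_iff.2 ⟨⟨x, A, hA, hxA⟩, ⟨hxA, hxξ⟩,
    fun y hy => Subtype.ext (hx y hy)⟩⟩
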